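/- All rings are commutative with identity. Let $R$ be a ring, $A$ an $R$-algebra and $\mathfrak{p}\subset R$ a prime ideal. Write $S^{-1}_{\mathfrak p}A$ for the localization of $A$ with respect to the image of $R\setminus\mathfrak p$, and $C_{\mathfrak p}A=\varprojlim_l A/\mathfrak p^lA$ for the $\mathfrak p$-adic completion of $A$. A flag of prime ideals $\Delta=(\mathfrak p_0,\ldots,\mathfrak p_n)$ of $R$ ($n\ge 0$) is a chain of prime ideals $\mathfrak p_0\subsetneq\mathfrak p_1\subsetneq\cdots\subsetneq\mathfrak p_n$, and for $R$ Noetherian the ind-pro completion of $R$ along $\Delta$ is the ring $$C_\Delta R=C_{\mathfrak p_0}S^{-1}_{\mathfrak p_0}C_{\mathfrak p_1}S^{-1}_{\mathfrak p_1}\cdots C_{\mathfrak p_n}S^{-1}_{\mathfrak p_n}R .$$ **Proposition.** Let $R$ be a Noetherian ring and let $\Delta=(\mathfrak p_0,\ldots,\mathfrak p_n)$ be a flag of prime ideals of $R$. Then $$\dim C_\Delta R=\mathrm{ht}\,\mathfrak p_0+\dim C_{\tilde\Delta}(R/\mathfrak p_0),$$ where $\dim$ is the Krull dimension, $\mathrm{ht}\,\mathfrak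 p_0$ is the height of $\mathfrak p_0$, and $\tilde\Delta=(\mathfrak p_0/\mathfrak p_0,\mathfrak p_1/\mathfrak p_0,\ldots,\mathfrak p_n/\mathfrak p_0)$ is the flag of prime ideals of $R/\mathfrak p_0$ obtained from $\Delta$ by reduction modulo $\mathfrak p_0$. -/

import Mathlib

universe u

namespace IndPro

/-- A flag of prime ideals `p₀ ⊊ p₁ ⊊ … ⊊ pₙ` (`n ≥ 0`) of `R`; its members are `Δ i` for
`i : Fin (n + 1)`, where `n = Δ.length`, and its first member `p₀` is `Δ.head`. -/
abbrev Flag (R : Type u) [CommRing R] : Type u := LTSeries (PrimeSpectrum R)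

section Step

variable {R : Type u} [CommRing R] (p : PrimeSpectrum R) (A : Type u) [CommRing A] [Algebra R A]

/-- `S_p⁻¹ A`: the localization of the `R`-algebra `A` at the prime ideal `p` of `R`, i.e. with
respect to the image in `A` of the complement `R \ p`. -/
abbrev LocAt : Type u := Localization (Algebra.algebraMapSubmonoid A p.asIdeal.primeCompl)

/-- `C_p A`: the completion `lim A / pˡ A` of the `R`-algebra `A` with respect to the prime ideal
`p` of `R`. -/
abbrev ComplAt : Type u := AdicCompletion (p.asIdeal.map (algebraMap R A)) A

end Step

/-- `C_{p₀} S_{p₀}⁻¹ … C_{pₙ} S_{pₙ}⁻¹ R` for a list `[p₀, …, pₙ]` of prime ideals of `R`, as an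
`R`-algebra; it is `R` itself for the empty list. -/
noncomputable def complList (R : Type u) [CommRing R] : List (PrimeSpectrum R) → CommAlgCat.{u} R
  | [] => CommAlgCat.of R R
  | p :: l => CommAlgCat.of R (ComplAt p (LocAt p (complList R l)))

/-- The ind-pro completion `C_Δ R` of `R` along the flag `Δ`. -/
noncomputable abbrev Completion {R : Type u} [CommRing R] (Δ : Flag R) : Type u :=
  complList R Δ.toList

/-- The prime ideal `q / p` of `R / p`, for prime ideals `p ⊆ q` of `R`. -/
def quotientPrime {R : Type u} [CommRing R] (p q : PrimeSpectrum R) (h : p ≤ q) :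
    PrimeSpectrum (R ⧸ p.asIdeal) where
  asIdeal := q.asIdeal.map (Ideal.Quotient.mk p.asIdeal)
  isPrime := Ideal.map_isPrime_of_surjective Ideal.Quotient.mk_surjective
    (by rw [Ideal.mk_ker]; exact h)

theorem comap_map_mk {R : Type u} [CommRing R] {p q : Ideal R} (h : p ≤ q) :
    (q.map (Ideal.Quotient.mk p)).comap (Ideal.Quotient.mk p) = q := by
  rw [Ideal.comap_map_of_surjective' _ Ideal.Quotient.mk_surjective, Ideal.mk_ker]
  exact sup_eq_left.mpr h

theorem quotientPrime_lt {R : Type u} [CommRing R] (p q q' : PrimeSpectrum R) (h : p ≤ q)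
    (h' : p ≤ q') (hq : q < q') : quotientPrime p q h < quotientPrime p q' h' := by
  refine lt_of_le_not_ge (Ideal.map_mono hq.le) fun hle => hq.not_ge ?_
  have hc := Ideal.comap_mono (f := Ideal.Quotient.mk p.asIdeal) hle
  change q'.asIdeal ≤ q.asIdeal
  rwa [show (quotientPrime p q' h').asIdeal = q'.asIdeal.map (Ideal.Quotient.mk p.asIdeal) from rfl,
    show (quotientPrime p q h).asIdeal = q.asIdeal.map (Ideal.Quotient.mk p.asIdeal) from rfl,
    comap_map_mk h, comap_map_mk h'] at hc

/-- `Δ mod p = (p₀/p, …, pₙ/p)`, a flag of prime ideals of `R / p`, for a prime ideal `p ⊆ p₀`. -/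
def Flag.mod {R : Type u} [CommRing R] (Δ : Flag R) (p : PrimeSpectrum R) (hp : p ≤ Δ.head) :
    Flag (R ⧸ p.asIdeal) where
  length := Δ.length
  toFun i := quotientPrime p (Δ i) (hp.trans (LTSeries.head_le Δ i))
  step i := quotientPrime_lt p _ _ _ _ (Δ.step i)

end IndPro

/-! Write `C` for the completion along the flag and `p₀` for its head. `C` is Noetherian and flat
over `R`. Every maximal ideal of `C` contracts to `p₀`, because the outermost step localizes at `p₀`
and then completes (`comap_algebraMap_complAt_locAt`). Going down for flat maps gives `ht M = ht p₀
+ ht (M / p₀C)` for each maximal `M`; taking suprema, `dim C = ht p₀ + dim C/p₀C`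
(`ringKrullDim_eq_height_add_ringKrullDim_quotient`). Localization and Noetherian completion commute
with quotients, so `C/p₀C` is the completion of `R/p₀` along the reduced flag
(`exists_surjective_complList`). -/

namespace AdicCompletion

/-! ### Adic completion: functoriality, Noetherianity, quotients. -/

variable {A B : Type*} [CommRing A] [CommRing B]

theorem ker_evalₐ_eq_map {I : Ideal A} (fg : I.FG) (n : ℕ) :
    RingHom.ker (evalₐ I n) = (I ^ n).map (algebraMap A (AdicCompletion I A)) := by
  ext x
  have h : evalₐ I n x = 0 ↔ eval I A n x = 0 := by
    have h1 : I ^ n • ⊤ ≤ I ^ n := by simp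
    have h2 : I ^ n ≤ I ^ n • ⊤ := by simp
    constructor
    · intro h; rw [← factor_evalₐ_eq_eval I x h2, h, _root_.map_zero]
    · intro h; rw [← factor_eval_eq_evalₐ I x h1, h, _root_.map_zero]
  rw [RingHom.mem_ker, h, ← LinearMap.mem_ker, ← pow_smul_top_eq_ker_eval fg,
    Ideal.smul_top_eq_map]
  rfl

theorem pow_le_comap_pow {f : A →+* B} {I : Ideal A} {J : Ideal B} (h : I.map f ≤ J) (n : ℕ) :
    I ^ n ≤ (J ^ n).comap f := by
  rw [← Ideal.map_le_iff_le_comap, Ideal.map_pow]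
  exact Ideal.pow_right_mono h n

theorem factorPow_comp_quotientMap_comp_evalₐ {f : A →+* B} {I : Ideal A} {J : Ideal B}
    (h : I.map f ≤ J) {m n : ℕ} (hle : m ≤ n) :
    (Ideal.Quotient.factorPow J hle).comp ((Ideal.quotientMap (J ^ n) f (pow_le_comap_pow h n)).comp
        (evalₐ I n : AdicCompletion I A →+* A ⧸ I ^ n)) =
      (Ideal.quotientMap (J ^ m) f (pow_le_comap_pow h m)).comp
        (evalₐ I m : AdicCompletion I A →+* A ⧸ I ^ m) := by
  ext x
  induction x using AdicCompletion.induction_on with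
  | _ x =>
    simp only [RingHom.comp_apply, RingHom.coe_coe, evalₐ_mk, Ideal.quotientMap_mk,
      Ideal.Quotient.factorPow, Ideal.Quotient.factor_mk]
    rw [Ideal.Quotient.eq, ← map_sub]
    exact pow_le_comap_pow h m (Ideal.Quotient.eq.1 (Ideal.mk_eq_mk I hle x))

/-- The ring homomorphism between adic completions induced by a ring homomorphism `f`. -/
noncomputable def mapRingHom (f : A →+* B) (I : Ideal A) (J : Ideal B) (h : I.map f ≤ J) :
    AdicCompletion I A →+* AdicCompletion J B :=
  liftRingHom J
    (fun n ↦ (Ideal.quotientMap (J ^ n) f (pow_le_comap_pow h n)).comp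
      (evalₐ I n : AdicCompletion I A →+* A ⧸ I ^ n))
    (factorPow_comp_quotientMap_comp_evalₐ h)

variable {f : A →+* B} {I : Ideal A} {J : Ideal B} (h : I.map f ≤ J)

theorem evalₐ_mapRingHom (n : ℕ) (x : AdicCompletion I A) :
    evalₐ J n (mapRingHom f I J h x) =
      Ideal.quotientMap (J ^ n) f (pow_le_comap_pow h n) (evalₐ I n x) :=
  evalₐ_liftRingHom J _ (factorPow_comp_quotientMap_comp_evalₐ h) n x

@[simp]
theorem mapRingHom_algebraMap (a : A) :
    mapRingHom f I J h (algebraMap A _ a) = algebraMap B _ (f a) := by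
  apply ext_evalₐ
  intro n
  rw [evalₐ_mapRingHom, AlgHom.commutes, AlgHom.commutes]
  exact Ideal.quotientMap_mk

/-- Surjectivity modulo `I` lifts, since the source is complete and the target Hausdorff. -/
theorem mapRingHom_surjective (hf : Function.Surjective f) (hJ : I.map f = J) (fg : I.FG) :
    Function.Surjective (mapRingHom f I J hJ.le) := by
  have := isAdicComplete_self I fg
  have hJfg : J.FG := hJ ▸ fg.map f
  have := isAdicComplete_self J hJfg
  have hmap : (I.map (algebraMap A (AdicCompletion I A))).map (mapRingHom f I J hJ.le) =
      J.map (algebraMap B (AdicCompletion J B)) := by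
    rw [Ideal.map_map]
    subst hJ
    rw [Ideal.map_map]
    congr 1
  have : IsHausdorff ((I.map (algebraMap A (AdicCompletion I A))).map (mapRingHom f I J hJ.le))
    (AdicCompletion J B) := by rw [hmap]; infer_instance
  refine surjective_of_mk_map_comp_surjective
    (I := I.map (algebraMap A (AdicCompletion I A))) _ fun y ↦ ?_
  obtain ⟨y, rfl⟩ := Ideal.Quotient.mk_surjective y
  obtain ⟨b, hb⟩ := Ideal.Quotient.mk_surjective (evalₐ J 1 y)
  obtain ⟨a, rfl⟩ := hf b
  refine ⟨algebraMap A _ a, ?_⟩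
  rw [RingHom.comp_apply, mapRingHom_algebraMap, Ideal.Quotient.eq, hmap,
    ← congrArg (Ideal.map _) (pow_one J), ← ker_evalₐ_eq_map hJfg, RingHom.mem_ker, map_sub, AlgHom.commutes, sub_eq_zero]
  exact hb

/-- Evaluating variables at generators of `I` presents the completion as a quotient of a power
series ring over `A`. -/
instance isNoetherianRing [IsNoetherianRing A] (I : Ideal A) :
    IsNoetherianRing (AdicCompletion I A) := by
  obtain ⟨n, s, hs⟩ := Submodule.fg_iff_exists_fin_generating_family.1
    (IsNoetherian.noetherian I)
  let g : MvPolynomial (Fin n) A →+* A := MvPolynomial.eval s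
  have hg : Function.Surjective g := fun a ↦ ⟨MvPolynomial.C a, by simp [g]⟩
  have hI : (MvPolynomial.idealOfVars (Fin n) A).map g = I := by
    rw [MvPolynomial.idealOfVars, Ideal.map_span, ← Set.range_comp, ← hs]
    congr 2
    ext1 i
    simp [g]
  have := isNoetherianRing_of_ringEquiv _
    (MvPowerSeries.toAdicCompletionAlgEquiv (Fin n) A).toRingEquiv
  exact isNoetherianRing_of_surjective _ _ _
    (mapRingHom_surjective hg hI (MvPolynomial.idealOfVars_fg _ _))

theorem ker_mapRingHom [IsNoetherianRing A] (hf : Function.Surjective f) (hJ : I.map f = J) :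
    RingHom.ker (mapRingHom f I J hJ.le) =
      (RingHom.ker f).map (algebraMap A (AdicCompletion I A)) := by
  have fg : I.FG := IsNoetherian.noetherian I
  set K := (RingHom.ker f).map (algebraMap A (AdicCompletion I A))
  apply le_antisymm
  · intro x hx
    have := isAdicComplete_self I fg
    -- Krull's intersection theorem makes `K` closed, so it suffices that `x ∈ K + Iⁿ` for every
    -- `n`.
    have hH : IsHausdorff (I.map (algebraMap A (AdicCompletion I A))) (AdicCompletion I A ⧸ K) :=
      IsHausdorff.of_le_jacobson _ _ (IsAdicComplete.le_jacobson_bot _)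
    rw [← Ideal.Quotient.eq_zero_iff_mem]
    refine hH.haus _ fun n ↦ ?_
    rw [SModEq.zero]
    obtain ⟨a, ha⟩ := Ideal.Quotient.mk_surjective (evalₐ I n x)
    have h1 : evalₐ J n (mapRingHom f I J hJ.le x) = 0 := by
      rw [RingHom.mem_ker.1 hx, _root_.map_zero]
    rw [evalₐ_mapRingHom, ← ha, Ideal.quotientMap_mk, Ideal.Quotient.eq_zero_iff_mem, ← hJ,
      ← Ideal.map_pow, Ideal.mem_map_iff_of_surjective f hf] at h1
    obtain ⟨c, hc, hca⟩ := h1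
    have h2 : x - algebraMap A _ c - algebraMap A _ (a - c) ∈
        (I ^ n).map (algebraMap A (AdicCompletion I A)) := by
      rw [← ker_evalₐ_eq_map fg, RingHom.mem_ker, map_sub, map_sub, AlgHom.commutes,
        AlgHom.commutes, ← ha]
      simp
    have h3 : algebraMap A (AdicCompletion I A) (a - c) ∈ K :=
      Ideal.mem_map_of_mem _ (by rw [RingHom.mem_ker, map_sub, hca, sub_self])
    have h4 : x - algebraMap A _ (a - c) ∈ (I.map (algebraMap A (AdicCompletion I A))) ^ n := by
      rw [← Ideal.map_pow]
      have := Ideal.add_mem _ h2 (Ideal.mem_map_of_mem (algebraMap A (AdicCompletion I A)) hc)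
      convert! this using 1
      ring
    have h5 : Ideal.Quotient.mk K x =
        (x - algebraMap A _ (a - c)) • (1 : AdicCompletion I A ⧸ K) := by
      rw [Algebra.smul_def, mul_one, Ideal.Quotient.algebraMap_eq, Ideal.Quotient.eq]
      simpa using h3
    rw [h5]
    exact Submodule.smul_mem_smul h4 trivial
  · rw [Ideal.map_le_iff_le_comap]
    intro a ha
    simp [RingHom.mem_ker.1 ha]

end AdicCompletion

/-! ### Ind-pro completion modulo a prime. -/

namespace IndPro

variable {R : Type u} [CommRing R]

theorem comap_quotientPrime {p q : PrimeSpectrum R} (h : p ≤ q) :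
    (quotientPrime p q h).asIdeal.comap (Ideal.Quotient.mk p.asIdeal) = q.asIdeal :=
  comap_map_mk h

instance isNoetherianRing_locAt (p : PrimeSpectrum R) (A : Type u) [CommRing A] [Algebra R A]
    [IsNoetherianRing A] : IsNoetherianRing (LocAt p A) :=
  IsLocalization.isNoetherianRing (Algebra.algebraMapSubmonoid A p.asIdeal.primeCompl) _ ‹_›

instance isNoetherianRing_complList [IsNoetherianRing R] (l : List (PrimeSpectrum R)) :
    IsNoetherianRing (complList R l) := by
  induction l with
  | nil => exact ‹IsNoetherianRing R›
  | cons p l ih =>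
    exact AdicCompletion.isNoetherianRing (A := LocAt p (complList R l)) _

instance flat_complList [IsNoetherianRing R] (l : List (PrimeSpectrum R)) :
    Module.Flat R (complList R l) := by
  induction l with
  | nil => exact Module.Flat.self
  | cons p l ih =>
    have : Module.Flat R (LocAt p (complList R l)) := inferInstance
    exact Module.Flat.trans R (LocAt p (complList R l)) (ComplAt p (LocAt p (complList R l)))

section Step

variable {p q : PrimeSpectrum R} (hpq : p ≤ q) {A : Type u} [CommRing A] [Algebra R A]
  {A' : Type u} [CommRing A'] [Algebra (R ⧸ p.asIdeal) A'] (φ : A →+* A')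
  (hφ : φ.comp (algebraMap R A) = (algebraMap _ A').comp (Ideal.Quotient.mk p.asIdeal))

include hφ in
theorem map_algebraMapSubmonoid_primeCompl :
    (Algebra.algebraMapSubmonoid A q.asIdeal.primeCompl).map φ =
      Algebra.algebraMapSubmonoid A' (quotientPrime p q hpq).asIdeal.primeCompl := by
  have h (x : R) : φ (algebraMap R A x) = algebraMap _ A' (Ideal.Quotient.mk p.asIdeal x) :=
    RingHom.congr_fun hφ x
  have hm (x : R) : Ideal.Quotient.mk p.asIdeal x ∈ (quotientPrime p q hpq).asIdeal ↔
      x ∈ q.asIdeal := by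
    rw [← Ideal.mem_comap, comap_quotientPrime]
  ext y
  constructor
  · rintro ⟨_, ⟨x, hx, rfl⟩, rfl⟩
    exact ⟨Ideal.Quotient.mk _ x, fun hx' ↦ hx ((hm x).1 hx'), (h x).symm⟩
  · rintro ⟨x, hx, rfl⟩
    obtain ⟨x, rfl⟩ := Ideal.Quotient.mk_surjective x
    exact ⟨_, ⟨x, fun hx' ↦ hx ((hm x).2 hx'), rfl⟩, h x⟩

include hφ in
theorem exists_surjective_locAt (hs : Function.Surjective φ)
    (hk : RingHom.ker φ = p.asIdeal.map (algebraMap R A)) :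
    ∃ ψ : LocAt q A →+* LocAt (quotientPrime p q hpq) A',
      ψ.comp (algebraMap R _) = (algebraMap _ _).comp (Ideal.Quotient.mk p.asIdeal) ∧
      Function.Surjective ψ ∧ RingHom.ker ψ = p.asIdeal.map (algebraMap R (LocAt q A)) := by
  have hS := map_algebraMapSubmonoid_primeCompl hpq φ hφ
  have hloc : IsLocalization ((Algebra.algebraMapSubmonoid A q.asIdeal.primeCompl).map φ)
      (LocAt (quotientPrime p q hpq) A') := by rw [hS]; infer_instance
  refine ⟨IsLocalization.map (M := Algebra.algebraMapSubmonoid A q.asIdeal.primeCompl)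
    (LocAt (quotientPrime p q hpq) A') φ (Submonoid.le_comap_map _), ?_, ?_, ?_⟩
  · rw [IsScalarTower.algebraMap_eq R A (LocAt q A), ← RingHom.comp_assoc, IsLocalization.map_comp,
      RingHom.comp_assoc, hφ, ← RingHom.comp_assoc, ← IsScalarTower.algebraMap_eq]
  · exact IsLocalization.map_surjective_of_surjective _ _ _ hs
  · rw [IsLocalization.ker_map (T := (Algebra.algebraMapSubmonoid A q.asIdeal.primeCompl).map φ)
      (LocAt (quotientPrime p q hpq) A') φ rfl, hk, Ideal.map_map, ← IsScalarTower.algebraMap_eq]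

include hφ in
theorem exists_surjective_complAt [IsNoetherianRing A] (hs : Function.Surjective φ)
    (hk : RingHom.ker φ = p.asIdeal.map (algebraMap R A)) :
    ∃ ψ : ComplAt q A →+* ComplAt (quotientPrime p q hpq) A',
      ψ.comp (algebraMap R _) = (algebraMap _ _).comp (Ideal.Quotient.mk p.asIdeal) ∧
      Function.Surjective ψ ∧ RingHom.ker ψ = p.asIdeal.map (algebraMap R (ComplAt q A)) := by
  have hJ : (q.asIdeal.map (algebraMap R A)).map φ =
      (quotientPrime p q hpq).asIdeal.map (algebraMap _ A') := by
    rw [Ideal.map_map, hφ, ← Ideal.map_map]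
    rfl
  refine ⟨AdicCompletion.mapRingHom φ _ _ hJ.le, ?_,
    AdicCompletion.mapRingHom_surjective hs hJ (IsNoetherian.noetherian _), ?_⟩
  · rw [IsScalarTower.algebraMap_eq R A (ComplAt q A),
      IsScalarTower.algebraMap_eq (R ⧸ p.asIdeal) A' (ComplAt (quotientPrime p q hpq) A')]
    ext x
    have h : φ (algebraMap R A x) = algebraMap _ A' (Ideal.Quotient.mk p.asIdeal x) :=
      RingHom.congr_fun hφ x
    simp only [RingHom.comp_apply, AdicCompletion.mapRingHom_algebraMap, h]
  · rw [AdicCompletion.ker_mapRingHom hs hJ, hk, Ideal.map_map, ← IsScalarTower.algebraMap_eq]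

end Step

/-- A surjection with kernel extended from `p` passes through each localization and each completion,
so induction on the list applies. -/
theorem exists_surjective_complList [IsNoetherianRing R] (p : PrimeSpectrum R)
    {l : List (PrimeSpectrum R)} {l' : List (PrimeSpectrum (R ⧸ p.asIdeal))}
    (hl : List.Forall₂ (fun q q' ↦ ∃ h : p ≤ q, q' = quotientPrime p q h) l l') :
    ∃ φ : complList R l →+* complList (R ⧸ p.asIdeal) l',
      φ.comp (algebraMap R _) = (algebraMap _ _).comp (Ideal.Quotient.mk p.asIdeal) ∧
      Function.Surjective φ ∧ RingHom.ker φ = p.asIdeal.map (algebraMap R (complList R l)) := by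
  induction hl with
  | nil =>
    have hs : Function.Surjective (Ideal.Quotient.mk p.asIdeal) := Ideal.Quotient.mk_surjective
    have hk : RingHom.ker (Ideal.Quotient.mk p.asIdeal) = p.asIdeal.map (algebraMap R R) :=
      Ideal.mk_ker.trans (Ideal.map_id _).symm
    exact ⟨Ideal.Quotient.mk p.asIdeal, rfl, hs, hk⟩
  | @cons q q' l l' hq _ ih =>
    obtain ⟨hpq, rfl⟩ := hq
    obtain ⟨φ, hφ, hs, hk⟩ := ih
    obtain ⟨ψ, hψ, hs, hk⟩ := exists_surjective_locAt hpq φ hφ hs hk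
    exact exists_surjective_complAt hpq ψ hψ hs hk

/-- Elements outside `p` become units, while completeness puts `p` in the Jacobson radical. -/
theorem comap_algebraMap_complAt_locAt (p : PrimeSpectrum R) {A : Type u} [CommRing A]
    [Algebra R A] [IsNoetherianRing (LocAt p A)] (M : Ideal (ComplAt p (LocAt p A)))
    [hM : M.IsMaximal] :
    M.comap (algebraMap R (ComplAt p (LocAt p A))) = p.asIdeal := by
  have hT := IsScalarTower.algebraMap_eq R (LocAt p A) (ComplAt p (LocAt p A))
  apply le_antisymm
  · intro x hx
    by_contra hxp
    have h1 : IsUnit (algebraMap R (LocAt p A) x) := by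
      rw [IsScalarTower.algebraMap_apply R A (LocAt p A)]
      exact IsLocalization.map_units (LocAt p A)
        (⟨algebraMap R A x, x, hxp, rfl⟩ : Algebra.algebraMapSubmonoid A p.asIdeal.primeCompl)
    have h2 := h1.map (algebraMap (LocAt p A) (ComplAt p (LocAt p A)))
    rw [← RingHom.comp_apply, ← hT] at h2
    exact hM.ne_top (Ideal.eq_top_of_isUnit_mem _ hx h2)
  · rw [← Ideal.map_le_iff_le_comap, hT, ← Ideal.map_map]
    have := AdicCompletion.isAdicComplete_self (p.asIdeal.map (algebraMap R (LocAt p A)))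
      (IsNoetherian.noetherian _)
    exact (IsAdicComplete.le_jacobson_bot _).trans (sInf_le ⟨bot_le, hM⟩)

end IndPro

/-! ### The dimension formula for flat extensions. -/

theorem ringKrullDim_eq_height_add_ringKrullDim_quotient {R S : Type*} [CommRing R] [CommRing S]
    [IsNoetherianRing R] [IsNoetherianRing S] [Algebra R S] [Module.Flat R S]
    (p : Ideal R) [p.IsPrime]
    (h : ∀ M : Ideal S, M.IsMaximal → M.comap (algebraMap R S) = p) :
    ringKrullDim S = p.height + ringKrullDim (S ⧸ p.map (algebraMap R S)) := by
  set I := p.map (algebraMap R S) with hI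
  have hle (M : Ideal S) (hM : M.IsMaximal) : I ≤ M := by
    rw [hI, Ideal.map_le_iff_le_comap, h M hM]
  have key (M : Ideal S) (hM : M.IsMaximal) :
      M.height = p.height + (M.map (Ideal.Quotient.mk I)).height := by
    have : M.LiesOver p := ⟨(h M hM).symm⟩
    exact Ideal.height_eq_height_add_of_liesOver_of_hasGoingDown p M
  rcases subsingleton_or_nontrivial S with hS | hS
  · have : Subsingleton (S ⧸ I) := Ideal.Quotient.mk_surjective.subsingleton
    rw [ringKrullDim_eq_bot_of_subsingleton, ringKrullDim_eq_bot_of_subsingleton, WithBot.add_bot]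
  obtain ⟨M₀, hM₀⟩ := Ideal.exists_maximal S
  have : Nontrivial (S ⧸ I) := Ideal.Quotient.nontrivial_iff.2 fun hI ↦
    hM₀.ne_top (top_le_iff.1 (hI ▸ hle M₀ hM₀))
  rw [← Ideal.sup_isMaximal_height_eq_ringKrullDim, ← Ideal.sup_isMaximal_height_eq_ringKrullDim,
    ← WithBot.coe_add, WithBot.coe_inj]
  apply le_antisymm
  · refine iSup₂_le fun M hM ↦ ?_
    rw [key M hM]
    have : (M.map (Ideal.Quotient.mk I)).IsMaximal :=
      Ideal.IsMaximal.map_of_surjective_of_ker_le Ideal.Quotient.mk_surjective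
        (by simpa using hle M hM)
    gcongr
    exact le_iSup₂_of_le _ this le_rfl
  -- Addition passes through the supremum because the index set is nonempty.
  · rw [ENat.add_biSup' (Ideal.exists_maximal (S ⧸ I))]
    refine iSup₂_le fun N hN ↦ ?_
    have hM := Ideal.comap_isMaximal_of_surjective (Ideal.Quotient.mk I)
      Ideal.Quotient.mk_surjective (K := N)
    refine le_iSup₂_of_le _ hM ?_
    rw [key _ hM, Ideal.map_comap_of_surjective _ Ideal.Quotient.mk_surjective]

theorem IndPro.ringKrullDim_complList_cons {R : Type u} [CommRing R] [IsNoetherianRing R]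
    (p : PrimeSpectrum R) (l : List (PrimeSpectrum R)) :
    ringKrullDim (complList R (p :: l)) = p.asIdeal.height +
      ringKrullDim (complList R (p :: l) ⧸
        p.asIdeal.map (algebraMap R (complList R (p :: l)))) := by
  exact ringKrullDim_eq_height_add_ringKrullDim_quotient p.asIdeal
    fun M hM ↦ comap_algebraMap_complAt_locAt p (A := complList R l) M (hM := hM)

theorem IndPro.Flag.forall₂_toList_mod {R : Type u} [CommRing R] (Δ : Flag R)
    (p : PrimeSpectrum R) (hp : p ≤ Δ.head) :
    List.Forall₂ (fun q q' ↦ ∃ h : p ≤ q, q' = quotientPrime p q h)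
      Δ.toList (Δ.mod p hp).toList := by
  rw [List.forall₂_iff_get]
  refine ⟨by simp [Flag.mod], fun i h₁ h₂ ↦ ?_⟩
  rw [List.get_eq_getElem, List.get_eq_getElem, RelSeries.toList_getElem,
    RelSeries.toList_getElem]
  exact ⟨hp.trans (LTSeries.head_le Δ _), rfl⟩

theorem mainTheorem7 {R : Type u} [CommRing R] [IsNoetherianRing R] (Δ : IndPro.Flag R) :
    ringKrullDim (IndPro.Completion Δ) =
      (Δ.head.asIdeal.height : WithBot ℕ∞) +
        ringKrullDim (IndPro.Completion (IndPro.Flag.mod Δ Δ.head le_rfl)) := by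
  obtain ⟨φ, -, hs, hk⟩ := IndPro.exists_surjective_complList Δ.head
    (Δ.forall₂_toList_mod Δ.head le_rfl)
  rw [← ringKrullDim_eq_of_ringEquiv (RingHom.quotientKerEquivOfSurjective hs), hk]
  have h : Δ.toList = Δ.head :: Δ.toList.tail := by
    rw [← RelSeries.head_toList, List.cons_head_tail]
  have key := IndPro.ringKrullDim_complList_cons Δ.head Δ.toList.tail
  rw [← h] at key
  exact key
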